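/- Let $M$ be a complex manifold (finite-dimensional, Hausdorff and second countable) that is taut, i.e. every sequence of holomorphic maps from the unit disc $\mathbb D\subset\mathbb C$ to $M$ has a subsequence which either converges, uniformly on compact subsets of $\mathbb D$, to a holomorphic map $\mathbb D\to M$, or is compactly divergent (for all compact $K\subset\mathbb D$ and $L\subset M$, the images of $K$ are eventually disjoint from $L$). Fix a (smooth) Hermitian metric on the complex tangent bundle of $M$ and let $d$ be the distance that it induces on $M$ (with $d=\infty$ between different connected components). Let $(\varphi_{s,t})_{0\le s\le t<+\infty}$ be an evolution family (of order $\infty$) on $M$, that is, a family of maps $M\to M$ such that 1. $\varphi_{s,s}=\mathrm{id}_M$ for all $s\ge 0$; 2. $\varphi_{s,t}=\varphi_{u,t}\circ\varphi_{s,u}$ for all $0\le s\le u\le t<+\infty$; 3. $\varphi_{s,t}:M\to M$ is holomorphic for all $0\le s\le t<+\infty$; 4. for every $T>0$ and every compact set $K\subset M$ there is a non-negative function $c_{T,K}\in L^\infty([0,T])$ such that $$\sup_{z\in K}d(\varphi_{s,t}(z),\varphi_{s,t'}(z))\le\int_{t'}^{t}c_{T,K}(\xi)\,d\xi\qquad\text{for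 all }0\le s\le t'\le t\le T.$$ Then for every $0\le s\le t<+\infty$ the map $\varphi_{s,t}:M\to M$ is univalent, i.e. holomorphic and injective. -/

import Mathlib

open Set Filter Topology MeasureTheory
open scoped Manifold ContDiff ENNReal Bundle

/-- A complex manifold modelled on `E` is, with the same charts, a real manifold modelled on the
real vector space underlying `E`. -/
instance realIsManifoldOfComplex {E : Type*} [NormedAddCommGroup E] [NormedSpace ℂ E]
    {M : Type*} [TopologicalSpace M] [ChartedSpace E M] {n : ℕ∞ω}
    [IsManifold 𝓘(ℂ, E) n M] : IsManifold 𝓘(ℝ, E) n M := by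
  refine isManifold_of_contDiffOn 𝓘(ℝ, E) n M ?_
  intro e e' he he'
  have h := (contDiffGroupoid n 𝓘(ℂ, E)).compatible he he'
  rw [contDiffGroupoid, mem_groupoid_of_pregroupoid] at h
  exact ContDiffOn.restrict_scalars ℝ h.1

/-- Multiplication by `i` on the tangent space of a complex manifold. The tangent space at `x` is
the model space `E`, through the preferred chart at `x`. -/
def tangentMulI {E : Type*} [NormedAddCommGroup E] [NormedSpace ℂ E]
    {M : Type*} [TopologicalSpace M] [ChartedSpace E M] (x : M)
    (v : TangentSpace 𝓘(ℝ, E) x) : TangentSpace 𝓘(ℝ, E) x :=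
  (Complex.I • (show E from v) : E)

/-- A smooth Hermitian metric on the tangent bundle of a complex manifold `M`, given by its real
part: a smooth Riemannian metric `g` with `g(iv, iw) = g(v, w)`. The Hermitian form itself is
`g(v, w) + i g(v, iw)` (antilinear in the second variable), and the norm of a tangent vector `v`
is `g(v, v)^(1/2)`. -/
structure HermitianMetric (E : Type*) [NormedAddCommGroup E] [NormedSpace ℂ E]
    (M : Type*) [TopologicalSpace M] [ChartedSpace E M] [IsManifold 𝓘(ℂ, E) ω M]
    extends Bundle.ContMDiffRiemannianMetric 𝓘(ℝ, E) ∞ E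
      (fun x : M => TangentSpace 𝓘(ℝ, E) x) where
  inner_mulI (x : M) (v w : TangentSpace 𝓘(ℝ, E) x) :
    inner x (tangentMulI x v) (tangentMulI x w) = inner x v w

/-- The distance induced on `M` by a Hermitian metric: the infimum of the lengths of the `C^1`
curves joining two points (it is `∞` if there is none, that is, between different components). -/
noncomputable def HermitianMetric.dist {E : Type*} [NormedAddCommGroup E] [NormedSpace ℂ E]
    {M : Type*} [TopologicalSpace M] [ChartedSpace E M] [IsManifold 𝓘(ℂ, E) ω M]
    (h : HermitianMetric E M) (x y : M) : ℝ≥0∞ :=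
  letI : Bundle.RiemannianBundle (fun x : M => TangentSpace 𝓘(ℝ, E) x) :=
    ⟨h.toContMDiffRiemannianMetric.toRiemannianMetric⟩
  Manifold.riemannianEDist 𝓘(ℝ, E) x y

/-- The sequence `F` of maps converges to `f` on `D` in the compact-open topology. For continuous
maps into a metrizable space this is uniform convergence on the compact subsets of `D`. -/
def ConvergesCompactlyOn {X M : Type*} [TopologicalSpace X] [TopologicalSpace M]
    (D : Set X) (F : ℕ → X → M) (f : X → M) : Prop :=
  ∀ K ⊆ D, IsCompact K → ∀ U : Set M, IsOpen U → MapsTo f K U →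
    ∀ᶠ k in atTop, MapsTo (F k) K U

/-- The sequence `F` of maps is compactly divergent on `D`: for all compact `K ⊆ D` and `L ⊆ M`,
the image `F k (K)` is eventually disjoint from `L`. -/
def CompactlyDivergentOn {X M : Type*} [TopologicalSpace X] [TopologicalSpace M]
    (D : Set X) (F : ℕ → X → M) : Prop :=
  ∀ K ⊆ D, IsCompact K → ∀ L : Set M, IsCompact L → ∀ᶠ k in atTop, Disjoint (F k '' K) L

/-- The complex manifold `M` is taut: the family of holomorphic maps from the unit disc to `M` is
normal, i.e. each sequence in it has a subsequence that either converges, uniformly on compact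
subsets, to a holomorphic map from the disc to `M`, or is compactly divergent. -/
def IsTaut (E : Type*) [NormedAddCommGroup E] [NormedSpace ℂ E]
    (M : Type*) [TopologicalSpace M] [ChartedSpace E M] : Prop :=
  ∀ F : ℕ → ℂ → M,
    (∀ k, MDifferentiableOn 𝓘(ℂ, ℂ) 𝓘(ℂ, E) (F k) (Metric.ball (0 : ℂ) 1)) →
    ∃ ψ : ℕ → ℕ, StrictMono ψ ∧
      ((∃ f : ℂ → M, MDifferentiableOn 𝓘(ℂ, ℂ) 𝓘(ℂ, E) f (Metric.ball (0 : ℂ) 1) ∧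
          ConvergesCompactlyOn (Metric.ball (0 : ℂ) 1) (fun k => F (ψ k)) f) ∨
        CompactlyDivergentOn (Metric.ball (0 : ℂ) 1) (fun k => F (ψ k)))

/-- `(φ s t)`, `0 ≤ s ≤ t < ∞`, is an evolution family of order `d ∈ [1, ∞]` on the complex
manifold `M`, with respect to the distance of the Hermitian metric `h`. The values of `φ` at other
pairs of times are irrelevant. -/
structure IsEvolutionFamilyOfOrder {E : Type*} [NormedAddCommGroup E] [NormedSpace ℂ E]
    {M : Type*} [TopologicalSpace M] [ChartedSpace E M] [IsManifold 𝓘(ℂ, E) ω M]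
    (d : ℝ≥0∞) (h : HermitianMetric E M) (φ : ℝ → ℝ → M → M) : Prop where
  one_le_order : 1 ≤ d
  self_eq_id : ∀ s : ℝ, 0 ≤ s → φ s s = id
  comp_eq : ∀ s u t : ℝ, 0 ≤ s → s ≤ u → u ≤ t → φ s t = φ u t ∘ φ s u
  holomorphic : ∀ s t : ℝ, 0 ≤ s → s ≤ t → MDifferentiable 𝓘(ℂ, E) 𝓘(ℂ, E) (φ s t)
  bound : ∀ T : ℝ, 0 < T → ∀ K : Set M, IsCompact K → ∃ c : ℝ → ℝ,
    (∀ ξ ∈ Icc 0 T, 0 ≤ c ξ) ∧ MemLp c d (volume.restrict (Icc 0 T)) ∧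
    ∀ s t' t : ℝ, 0 ≤ s → s ≤ t' → t' ≤ t → t ≤ T →
      ⨆ z ∈ K, h.dist (φ s t z) (φ s t' z) ≤ ENNReal.ofReal (∫ ξ in t'..t, c ξ)

/-- An evolution family is an evolution family of order `∞`. -/
def IsEvolutionFamily {E : Type*} [NormedAddCommGroup E] [NormedSpace ℂ E]
    {M : Type*} [TopologicalSpace M] [ChartedSpace E M] [IsManifold 𝓘(ℂ, E) ω M]
    (h : HermitianMetric E M) (φ : ℝ → ℝ → M → M) : Prop :=
  IsEvolutionFamilyOfOrder ∞ h φ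

/-- A self-map of a complex manifold is univalent if it is holomorphic and injective. -/
def IsUnivalent (E : Type*) [NormedAddCommGroup E] [NormedSpace ℂ E]
    {M : Type*} [TopologicalSpace M] [ChartedSpace E M] (f : M → M) : Prop :=
  MDifferentiable 𝓘(ℂ, E) 𝓘(ℂ, E) f ∧ Function.Injective f

/-! Two orbits that meet at time `t` have a first meeting time `v`, since orbits are continuous in
time. If `v > s`, let `p` be the common point. For `u < v` near `v`, `φ u v` is uniformly close to
the identity on a fixed compact set near `p`, so Cauchy estimates make it injective on a
neighbourhood of `p` independent of `u` (`eventually_injOn`, via `exists_injOn_of_dist_lt`). Both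
orbits lie there at time `u`, hence they already agree at `u`, contradicting minimality. So `v = s`
and the starting points coincide. -/

/-- A holomorphic map that is uniformly close to the identity on a ball is injective on the
concentric ball of half the radius. -/
theorem injOn_ball_of_dist_self_lt {E : Type*} [NormedAddCommGroup E] [NormedSpace ℂ E]
    {f : E → E} {a : E} {r : ℝ} (hr : 0 < r)
    (hf : DifferentiableOn ℂ f (Metric.ball a (2 * r)))
    (hclose : ∀ x ∈ Metric.ball a (2 * r), dist x (f x) < r / 8) :
    InjOn f (Metric.ball a r) := by
  set g : E → E := fun x => f x - x with hg
  have hgd : DifferentiableOn ℂ g (Metric.ball a (2 * r)) := hf.sub differentiableOn_id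
  have hgn : ∀ x ∈ Metric.ball a (2 * r), ‖g x‖ < r / 8 := by
    intro x hx
    have := hclose x hx
    rwa [dist_comm, dist_eq_norm] at this
  have hsub : ∀ x ∈ Metric.ball a r, Metric.ball x r ⊆ Metric.ball a (2 * r) := by
    intro x hx
    apply Metric.ball_subset_ball'
    have := Metric.mem_ball.1 hx
    linarith
  have hmem : ∀ x ∈ Metric.ball a r, x ∈ Metric.ball a (2 * r) := fun x hx =>
    hsub x hx (Metric.mem_ball_self hr)
  have hderiv : ∀ x ∈ Metric.ball a r, ‖fderiv ℂ g x‖ ≤ 1 / 4 := by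
    intro x hx
    -- Oscillation at most `r / 4` on a ball of radius `r` gives derivative at most `1 / 4` by
    -- Cauchy; any constant below `1` would do.
    have hmaps : MapsTo g (Metric.ball x r) (Metric.closedBall (g x) (r / 4)) := by
      intro y hy
      have h1 := hgn y (hsub x hx hy)
      have h2 := hgn x (hmem x hx)
      rw [Metric.mem_closedBall, dist_eq_norm]
      have := norm_sub_le (g y) (g x)
      linarith
    have := Complex.norm_fderiv_le_div_of_mapsTo_ball (hgd.mono (hsub x hx)) hmaps hr
    refine this.trans (le_of_eq ?_)
    field_simp
  intro x hx y hy hxy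
  have hmv : ‖g y - g x‖ ≤ 1 / 4 * ‖y - x‖ :=
    (convex_ball a r).norm_image_sub_le_of_norm_fderiv_le (𝕜 := ℂ)
      (fun z hz => hgd.differentiableAt (Metric.isOpen_ball.mem_nhds (hmem z hz))) hderiv hx hy
  have heq : g y - g x = -(y - x) := by
    simp only [hg, hxy]
    abel
  rw [heq, norm_neg] at hmv
  have h0 : ‖y - x‖ = 0 := le_antisymm (by linarith [norm_nonneg (y - x)]) (norm_nonneg _)
  exact (sub_eq_zero.1 (norm_eq_zero.1 h0)).symm

/-! ### The Hermitian distance, and maps close to the identity -/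

namespace HermitianMetric

section Dist

variable {E : Type*} [NormedAddCommGroup E] [NormedSpace ℂ E]
  {M : Type*} [TopologicalSpace M] [ChartedSpace E M] [IsManifold 𝓘(ℂ, E) ω M]

theorem isContinuousRiemannianBundle (h : HermitianMetric E M) :
    letI : Bundle.RiemannianBundle (fun x : M => TangentSpace 𝓘(ℝ, E) x) :=
      ⟨h.toContMDiffRiemannianMetric.toRiemannianMetric⟩
    haveI : IsManifold 𝓘(ℝ, E) 1 M := IsManifold.of_le (n := ω) le_top
    IsContinuousRiemannianBundle E (fun x : M => TangentSpace 𝓘(ℝ, E) x) :=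
  letI : Bundle.RiemannianBundle (fun x : M => TangentSpace 𝓘(ℝ, E) x) :=
    ⟨h.toContMDiffRiemannianMetric.toRiemannianMetric⟩
  ⟨⟨h.toContMDiffRiemannianMetric.inner,
    h.toContMDiffRiemannianMetric.toContinuousRiemannianMetric.continuous, fun _ _ _ => rfl⟩⟩

theorem dist_comm (h : HermitianMetric E M) (x y : M) : h.dist x y = h.dist y x :=
  let : Bundle.RiemannianBundle (fun x : M => TangentSpace 𝓘(ℝ, E) x) :=
    ⟨h.toContMDiffRiemannianMetric.toRiemannianMetric⟩
  Manifold.riemannianEDist_comm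

theorem dist_triangle (h : HermitianMetric E M) (x y z : M) :
    h.dist x z ≤ h.dist x y + h.dist y z :=
  let : Bundle.RiemannianBundle (fun x : M => TangentSpace 𝓘(ℝ, E) x) :=
    ⟨h.toContMDiffRiemannianMetric.toRiemannianMetric⟩
  have : IsManifold 𝓘(ℝ, E) 1 M := IsManifold.of_le (n := ω) le_top
  Manifold.riemannianEDist_triangle

theorem eventually_dist_lt (h : HermitianMetric E M) (x : M) {c : ℝ≥0∞} (hc : 0 < c) :
    ∀ᶠ y in 𝓝 x, h.dist x y < c := by
  let : Bundle.RiemannianBundle (fun x : M => TangentSpace 𝓘(ℝ, E) x) :=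
    ⟨h.toContMDiffRiemannianMetric.toRiemannianMetric⟩
  have : IsManifold 𝓘(ℝ, E) 1 M := IsManifold.of_le (n := ω) le_top
  have := h.isContinuousRiemannianBundle
  exact eventually_riemannianEDist_lt 𝓘(ℝ, E) x hc

theorem exists_dist_lt_subset [RegularSpace M] (h : HermitianMetric E M) {x : M} {s : Set M}
    (hs : s ∈ 𝓝 x) : ∃ c > 0, ∀ y, h.dist x y < c → y ∈ s := by
  let : Bundle.RiemannianBundle (fun x : M => TangentSpace 𝓘(ℝ, E) x) :=
    ⟨h.toContMDiffRiemannianMetric.toRiemannianMetric⟩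
  have : IsManifold 𝓘(ℝ, E) 1 M := IsManifold.of_le (n := ω) le_top
  have := h.isContinuousRiemannianBundle
  obtain ⟨c, hc, H⟩ := setOfPred_riemannianEDist_lt_subset_nhds' 𝓘(ℝ, E) hs
  exact ⟨c, hc, fun y hy => H hy⟩

theorem tendsto_nhds_of_dist [RegularSpace M] (h : HermitianMetric E M) {ι : Type*}
    {l : Filter ι} {F : ι → M} {x : M} (hF : Tendsto (fun i => h.dist x (F i)) l (𝓝 0)) :
    Tendsto F l (𝓝 x) := by
  intro s hs
  obtain ⟨c, hc, H⟩ := h.exists_dist_lt_subset hs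
  filter_upwards [hF.eventually_lt_const hc] with i hi using H _ hi

/-- The distance of a Hermitian metric controls, uniformly on a compact set, every neighbourhood
of the diagonal. -/
theorem exists_forall_dist_lt_mem [RegularSpace M] (h : HermitianMetric E M) {K : Set M}
    (hK : IsCompact K) {W : Set (M × M)} (hW : ∀ x ∈ K, W ∈ 𝓝 (x, x)) :
    ∃ δ > 0, ∀ x ∈ K, ∀ y, h.dist x y < δ → (x, y) ∈ W := by
  refine hK.induction_on (p := fun S => ∃ δ > 0, ∀ x ∈ S, ∀ y, h.dist x y < δ → (x, y) ∈ W)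
    ⟨1, one_pos, by simp⟩ ?_ ?_ ?_
  · rintro S T hST ⟨δ, hδ, H⟩
    exact ⟨δ, hδ, fun x hx => H x (hST hx)⟩
  · rintro S T ⟨δ, hδ, H⟩ ⟨δ', hδ', H'⟩
    refine ⟨min δ δ', lt_min hδ hδ', ?_⟩
    rintro x (hx | hx) y hy
    · exact H x hx y (hy.trans_le (min_le_left _ _))
    · exact H' x hx y (hy.trans_le (min_le_right _ _))
  · intro x hx
    have hWx := hW x hx
    rw [nhds_prod_eq, mem_prod_self_iff] at hWx
    obtain ⟨s, hs, hsW⟩ := hWx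
    obtain ⟨c, hc, H⟩ := h.exists_dist_lt_subset hs
    -- Half the radius for `y` near `x`, half for `z` near `y`, so that both stay in `s`.
    have hc2 : 0 < c / 2 := ENNReal.half_pos hc.ne'
    have hle : c / 2 ≤ c := ENNReal.half_le_self
    refine ⟨{y | h.dist x y < c / 2}, mem_nhdsWithin_of_mem_nhds (h.eventually_dist_lt x hc2),
      c / 2, hc2, fun y hy z hz => hsW ⟨H y (lt_of_lt_of_le hy hle), H z ?_⟩⟩
    calc h.dist x z ≤ h.dist x y + h.dist y z := h.dist_triangle x y z
      _ < c / 2 + c / 2 := ENNReal.add_lt_add hy hz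
      _ = c := ENNReal.add_halves c

end Dist

/-- Holomorphic self-maps that are uniformly close to the identity on a suitable compact set are
injective on a fixed neighbourhood of a given point. -/
theorem exists_injOn_of_dist_lt {E : Type*} [NormedAddCommGroup E] [NormedSpace ℂ E]
    [FiniteDimensional ℂ E] {M : Type*} [TopologicalSpace M] [RegularSpace M]
    [ChartedSpace E M] [IsManifold 𝓘(ℂ, E) ω M] (h : HermitianMetric E M) (p : M) :
    ∃ K : Set M, IsCompact K ∧ ∃ V ∈ 𝓝 p, ∃ δ > 0, ∀ f : M → M,
      MDifferentiable 𝓘(ℂ, E) 𝓘(ℂ, E) f → (∀ x ∈ K, h.dist x (f x) < δ) → InjOn f V := by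
  have : ProperSpace E := FiniteDimensional.proper ℂ E
  have : IsManifold 𝓘(ℂ, E) 1 M := IsManifold.of_le (n := ω) le_top
  set e := extChartAt 𝓘(ℂ, E) p with he
  have hto : IsOpen e.target := isOpen_extChartAt_target p
  have hso : IsOpen e.source := isOpen_extChartAt_source p
  have hec : ContinuousOn e e.source := continuousOn_extChartAt p
  obtain ⟨R, hR, hRt⟩ := Metric.nhds_basis_closedBall.mem_iff.1
    (hto.mem_nhds (mem_extChartAt_target (I := 𝓘(ℂ, E)) p))
  obtain ⟨r, hr, rfl⟩ : ∃ r : ℝ, 0 < r ∧ R = 2 * r := ⟨R / 2, by positivity, by ring⟩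
  have hKc : IsCompact (e.symm '' Metric.closedBall (e p) (2 * r)) :=
    (isCompact_closedBall _ _).image_of_continuousOn
      ((continuousOn_extChartAt_symm (I := 𝓘(ℂ, E)) p).mono hRt)
  have hKs : ∀ x ∈ e.symm '' Metric.closedBall (e p) (2 * r), x ∈ e.source := by
    rintro _ ⟨y, hy, rfl⟩
    exact e.map_target (hRt hy)
  -- `W` encodes that the image stays in the chart domain and moves by less than `r / 8` in the
  -- chart, as `injOn_ball_of_dist_self_lt` requires.
  obtain ⟨δ, hδ, H⟩ := h.exists_forall_dist_lt_mem hKc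
    (W := {q | q.2 ∈ e.source ∧ Dist.dist (e q.1) (e q.2) < r / 8}) (by
      intro x hx
      have hxs := hso.mem_nhds (hKs x hx)
      have hca : ContinuousAt e x := hec.continuousAt hxs
      have h2 : Tendsto (fun q : M × M => Dist.dist (e q.1) (e q.2)) (𝓝 (x, x))
          (𝓝 (Dist.dist (e x) (e x))) :=
        (hca.tendsto.comp continuousAt_fst.tendsto).dist (hca.tendsto.comp continuousAt_snd.tendsto)
      rw [dist_self] at h2
      exact inter_mem (continuousAt_snd (p := (x, x)) hxs)
        (h2.eventually_lt_const (by positivity)))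
  refine ⟨_, hKc, e.source ∩ e ⁻¹' Metric.ball (e p) r, ?_, δ, hδ, fun f hf hfd => ?_⟩
  · exact inter_mem (extChartAt_source_mem_nhds p)
      ((continuousAt_extChartAt p).preimage_mem_nhds (Metric.ball_mem_nhds _ hr))
  · have hclose : ∀ x ∈ Metric.ball (e p) (2 * r),
        f (e.symm x) ∈ e.source ∧ Dist.dist x (e (f (e.symm x))) < r / 8 := by
      intro x hx
      have hx' := Metric.ball_subset_closedBall hx
      have := H _ (mem_image_of_mem _ hx') _ (hfd _ (mem_image_of_mem _ hx'))
      simpa [e.right_inv (hRt hx')] using this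
    have hdiff : DifferentiableOn ℂ (fun x => e (f (e.symm x))) (Metric.ball (e p) (2 * r)) := by
      rw [← mdifferentiableOn_iff_differentiableOn]
      have h1 : MDifferentiableOn 𝓘(ℂ, E) 𝓘(ℂ, E) e.symm (Metric.ball (e p) (2 * r)) :=
        (mdifferentiableOn_extChartAt_symm (I := 𝓘(ℂ, E)) (x := p)).mono
          (Metric.ball_subset_closedBall.trans hRt)
      have h2 : MDifferentiableOn 𝓘(ℂ, E) 𝓘(ℂ, E) e e.source := by
        rw [he, extChartAt_source]
        exact mdifferentiableOn_extChartAt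
      exact h2.comp (hf.comp_mdifferentiableOn h1) fun x hx => (hclose x hx).1
    have hinj := injOn_ball_of_dist_self_lt hr hdiff fun x hx => (hclose x hx).2
    rintro x ⟨hxs, hx⟩ y ⟨hys, hy⟩ hxy
    refine e.injOn hxs hys (hinj hx hy ?_)
    simp only [e.left_inv hxs, e.left_inv hys, hxy]

end HermitianMetric

/-! ### Evolution families: dependence on time and injectivity -/

namespace IsEvolutionFamilyOfOrder

variable {E : Type*} [NormedAddCommGroup E] [NormedSpace ℂ E]
  {M : Type*} [TopologicalSpace M] [ChartedSpace E M] [IsManifold 𝓘(ℂ, E) ω M]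
  {d : ℝ≥0∞} {h : HermitianMetric E M} {φ : ℝ → ℝ → M → M}

/-- `F` is a primitive of the bound `c`, which is integrable because `1 ≤ d` and the interval is
bounded. `F` does not depend on the initial time `s`. -/
theorem exists_dist_le_sub (hφ : IsEvolutionFamilyOfOrder d h φ) {T : ℝ} (hT : 0 < T)
    {K : Set M} (hK : IsCompact K) :
    ∃ F : ℝ → ℝ, ContinuousOn F (Icc 0 T) ∧ ∀ s t' t : ℝ, 0 ≤ s → s ≤ t' → t' ≤ t → t ≤ T →
      ∀ z ∈ K, h.dist (φ s t z) (φ s t' z) ≤ ENNReal.ofReal (F t - F t') := by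
  obtain ⟨c, -, hc, H⟩ := hφ.bound T hT K hK
  have hint : IntegrableOn c (uIcc 0 T) volume := by
    rw [uIcc_of_le hT.le]
    exact hc.integrable hφ.one_le_order
  have hii : ∀ u ∈ Icc 0 T, IntervalIntegrable c volume 0 u := fun u hu =>
    (hint.mono_set (uIcc_subset_uIcc_left (by rwa [uIcc_of_le hT.le]))).intervalIntegrable
  refine ⟨fun u => ∫ ξ in (0 : ℝ)..u, c ξ, ?_, fun s t' t hs hst' ht't htT z hz => ?_⟩
  · have := intervalIntegral.continuousOn_primitive_interval hint
    rwa [uIcc_of_le hT.le] at this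
  · rw [intervalIntegral.integral_interval_sub_left
      (hii t ⟨hs.trans (hst'.trans ht't), htT⟩) (hii t' ⟨hs.trans hst', ht't.trans htT⟩)]
    exact (le_iSup₂ (f := fun z (_ : z ∈ K) => h.dist (φ s t z) (φ s t' z)) z hz).trans
      (H s t' t hs hst' ht't htT)

theorem continuousOn_orbit [RegularSpace M] (hφ : IsEvolutionFamilyOfOrder d h φ) {s T : ℝ}
    (hs : 0 ≤ s) (hT : 0 < T) (z : M) : ContinuousOn (fun u => φ s u z) (Icc s T) := by
  obtain ⟨F, hF, H⟩ := hφ.exists_dist_le_sub hT (isCompact_singleton (x := z))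
  intro u hu
  apply h.tendsto_nhds_of_dist
  -- The absolute value covers times on either side of `u`.
  have hlim : Tendsto (fun v => ENNReal.ofReal |F v - F u|) (𝓝[Icc s T] u) (𝓝 0) := by
    have h1 : Tendsto F (𝓝[Icc s T] u) (𝓝 (F u)) :=
      (hF.mono (Icc_subset_Icc_left hs)) u hu
    simpa using ENNReal.tendsto_ofReal (h1.sub_const (F u)).abs
  refine tendsto_of_tendsto_of_tendsto_of_le_of_le' tendsto_const_nhds hlim
    (Eventually.of_forall fun _ => zero_le) ?_
  filter_upwards [self_mem_nhdsWithin] with v hv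
  rcases le_total u v with huv | hvu
  · rw [h.dist_comm]
    exact (H s u v hs hu.1 huv hv.2 z rfl).trans (ENNReal.ofReal_le_ofReal (le_abs_self _))
  · refine (H s v u hs hv.1 hvu hu.2 z rfl).trans (ENNReal.ofReal_le_ofReal ?_)
    rw [abs_sub_comm]
    exact le_abs_self _

/-- The members of an evolution family are injective near a given point if the time interval is
short enough. -/
theorem eventually_injOn [FiniteDimensional ℂ E] [RegularSpace M]
    (hφ : IsEvolutionFamilyOfOrder d h φ) {t : ℝ} (ht : 0 < t) (p : M) :
    ∃ V ∈ 𝓝 p, ∀ᶠ u in 𝓝[<] t, InjOn (φ u t) V := by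
  obtain ⟨K, hK, V, hV, δ, hδ, H⟩ := h.exists_injOn_of_dist_lt p
  obtain ⟨F, hF, hFd⟩ := hφ.exists_dist_le_sub ht hK
  refine ⟨V, hV, ?_⟩
  have hlim : Tendsto (fun u => ENNReal.ofReal (F t - F u)) (𝓝[<] t) (𝓝 0) := by
    have h1 : Tendsto F (𝓝[<] t) (𝓝 (F t)) :=
      (hF t (right_mem_Icc.2 ht.le)).mono_of_mem_nhdsWithin
        (mem_of_superset (Ioo_mem_nhdsLT ht) Ioo_subset_Icc_self)
    simpa using ENNReal.tendsto_ofReal (h1.const_sub (F t))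
  filter_upwards [hlim.eventually_lt_const hδ, Ioo_mem_nhdsLT ht] with u hu hut
  refine H _ (hφ.holomorphic u t hut.1.le hut.2.le) fun x hx => ?_
  -- With initial time `u` itself, `φ u u = id`, so the estimate bounds the displacement of `φ u t`
  -- on `K`.
  have := hFd u u t hut.1.le le_rfl hut.2.le le_rfl x hx
  rw [hφ.self_eq_id u hut.1.le, h.dist_comm] at this
  exact this.trans_lt hu

/-- Two orbits that meet coincide from the start. -/
theorem injective [FiniteDimensional ℂ E] [T2Space M] (hφ : IsEvolutionFamilyOfOrder d h φ)
    {s t : ℝ} (hs : 0 ≤ s) (hst : s ≤ t) : Function.Injective (φ s t) := by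
  have : ProperSpace E := FiniteDimensional.proper ℂ E
  have : LocallyCompactSpace M := ChartedSpace.locallyCompactSpace E M
  intro z w hzw
  by_contra hne
  have hst' : s < t := by
    refine lt_of_le_of_ne hst fun hEq => hne ?_
    rw [← hEq, hφ.self_eq_id s hs] at hzw
    exact hzw
  have ht : 0 < t := hs.trans_lt hst'
  have hz := hφ.continuousOn_orbit hs ht z
  have hw := hφ.continuousOn_orbit hs ht w
  set S := {u | u ∈ Icc s t ∧ φ s u z = φ s u w} with hS
  have hSclosed : IsClosed S := isClosed_Icc.isClosed_eq hz hw
  have hSbdd : BddBelow S := ⟨s, fun u hu => hu.1.1⟩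
  obtain ⟨⟨hsu, hut⟩, hmeet⟩ : sInf S ∈ S :=
    hSclosed.csInf_mem ⟨t, right_mem_Icc.2 hst, hzw⟩ hSbdd
  set v := sInf S with hv
  have hsv : s < v := by
    refine lt_of_le_of_ne hsu fun hEq => hne ?_
    rw [← hEq, hφ.self_eq_id s hs] at hmeet
    exact hmeet
  obtain ⟨V, hV, hinj⟩ := hφ.eventually_injOn (hs.trans_lt hsv) (φ s v z)
  have hIcc : Icc s t ∈ 𝓝[<] v :=
    mem_of_superset (Ioo_mem_nhdsLT hsv) fun u hu => ⟨hu.1.le, hu.2.le.trans hut⟩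
  have hzV : ∀ᶠ u in 𝓝[<] v, φ s u z ∈ V :=
    (hz v ⟨hsu, hut⟩).mono_of_mem_nhdsWithin hIcc hV
  have hwV : ∀ᶠ u in 𝓝[<] v, φ s u w ∈ V := by
    -- `V` is a neighbourhood of the common point, so it captures the second orbit too.
    rw [hmeet] at hV
    exact (hw v ⟨hsu, hut⟩).mono_of_mem_nhdsWithin hIcc hV
  obtain ⟨u, hu, huz, huw, huv⟩ :=
    (hinj.and (hzV.and (hwV.and (Ioo_mem_nhdsLT hsv)))).exists
  have hcomp := hφ.comp_eq s u v hs huv.1.le huv.2.le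
  have hEq : φ s u z = φ s u w := by
    refine hu huz huw ?_
    simpa only [hcomp, Function.comp_apply] using hmeet
  exact (csInf_le hSbdd ⟨⟨huv.1.le, huv.2.le.trans hut⟩, hEq⟩).not_gt huv.2

end IsEvolutionFamilyOfOrder

theorem proposition5p1 {E : Type*} [NormedAddCommGroup E] [NormedSpace ℂ E]
    [FiniteDimensional ℂ E] {M : Type*} [TopologicalSpace M] [T2Space M]
    [SecondCountableTopology M] [ChartedSpace E M] [IsManifold 𝓘(ℂ, E) ω M]
    (hM : IsTaut E M) (h : HermitianMetric E M) (φ : ℝ → ℝ → M → M)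
    (hφ : IsEvolutionFamily h φ) (s t : ℝ) (hs : 0 ≤ s) (hst : s ≤ t) :
    IsUnivalent E (φ s t) :=
  ⟨hφ.holomorphic s t hs hst, hφ.injective hs hst⟩
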